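/- Let $e,n\ge 2$ and $1\le k\le e-1$ be integers and let $\zeta$ be a primitive $e$-th root of unity in $\mathbb{C}$. Let $G(e,e,n)$ be the group of $n\times n$ monomial complex matrices whose nonzero entries are $e$-th roots of unity with product $1$. It is generated by $X=\{t_i : i\in\mathbb{Z}/e\mathbb{Z}\}\cup\{s_j : 3\le j\le n\}$, where $$t_i=\begin{pmatrix}0&\zeta^{-i}&0\\ \zeta^{i}&0&0\\ 0&0&I_{n-2}\end{pmatrix}$$ and $s_j$ is the permutation matrix of the transposition $(j-1\;\, j)$. Let $\ell$ be the word length on $G(e,e,n)$ with respect to $X$; a reduced expression of $w$ is a word of length $\ell(w)$ over $X$ that represents $w$. Write $g\preceq f$ if $f=gh$ for some $h\in G(e,e,n)$ with $\ell(f)=\ell(g)+\ell(h)$, and let $[1,w]=\{f : 1\preceq f\preceq w\}$. Let $\lambda=\mathrm{diag}(\zeta^{-(n-1)},\zeta,\dots,\zeta)$. Let $M([1,\lambda^k])$ be the interval monoid, i.e. the monoid presented by generators $\underline{w}$ for $w\in[1,\lambda^k]$, with relations $\underline{w}=\underline{w'}\,\underline{w''}$ whenever $w,w',w''\in[1,\lambda^k]$,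 $w=w'w''$ and $\ell(w)=\ell(w')+\ell(w'')$, and with $\underline{1}$ equal to the unit of the monoid. Let $B^{\oplus k}(e,e,n)$ be the monoid presented by generators $\tilde t_i$ ($i\in\mathbb{Z}/e\mathbb{Z}$) and $\tilde s_j$ ($3\le j\le n$) with relations * $\tilde s_i\tilde s_j\tilde s_i=\tilde s_j\tilde s_i\tilde s_j$ for $|i-j|=1$, * $\tilde s_i\tilde s_j=\tilde s_j\tilde s_i$ for $|i-j|>1$, * $\tilde s_3\tilde t_i\tilde s_3=\tilde t_i\tilde s_3\tilde t_i$ for $i\in\mathbb{Z}/e\mathbb{Z}$ (if $n\ge 3$), * $\tilde s_j\tilde t_i=\tilde t_i\tilde s_j$ for $i\in\mathbb{Z}/e\mathbb{Z}$ and $4\le j\le n$, * $\tilde t_i\tilde t_{i-k}=\tilde t_j\tilde t_{j-k}$ for $i,j\in\mathbb{Z}/e\mathbb{Z}$. Then: 1. There is a unique map $F:[1,\lambda^k]\to B^{\oplus k}(e,e,n)$ such that $F(w)=\tilde x_1\cdots\tilde x_r$ for every $w\in[1,\lambda^k]$ and every reduced expression $x_1\cdots x_r$ of $w$; in particular, any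 two reduced expressions of $w$ are related by the defining relations of $B^{\oplus k}(e,e,n)$. 2. $X\subseteq[1,\lambda^k]$, and there is an isomorphism of monoids $B^{\oplus k}(e,e,n)\to M([1,\lambda^k])$ that sends $\tilde x$ to $\underline{x}$ for every $x\in X$. -/

import Mathlib

/-! ## Word length, divisibility and interval monoids in a group -/

namespace IntervalStructure

section General

variable {G A : Type*} [Group G]

/-- The word `l` over the alphabet `A` represents `w`, where the letter `x` stands for the
group element `gen x`. -/
def Represents (gen : A → G) (l : List A) (w : G) : Prop :=
  (l.map gen).prod = w

/-- The length of `w` over the generators `gen x`: the minimal length of a word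
representing `w`. -/
noncomputable def len (gen : A → G) (w : G) : ℕ :=
  sInf {r : ℕ | ∃ l : List A, l.length = r ∧ Represents gen l w}

/-- A reduced expression of `w`: a word representing `w` of length `len gen w`. -/
def IsReducedExpression (gen : A → G) (l : List A) (w : G) : Prop :=
  Represents gen l w ∧ l.length = len gen w

/-- `g` divides `f`: there is `h` with `f = g h` and `ℓ(f) = ℓ(g) + ℓ(h)`. -/
def Divides (gen : A → G) (g f : G) : Prop :=
  ∃ h : G, f = g * h ∧ len gen f = len gen g + len gen h

/-- The interval `[1, w]`. -/
def interval (gen : A → G) (w : G) : Set G :=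
  {f : G | Divides gen 1 f ∧ Divides gen f w}

/-- The defining relations of the interval monoid: `h = f g` (as generators) whenever
`f, g, h ∈ [1, w]`, `h = f g` in `G` and `ℓ(h) = ℓ(f) + ℓ(g)`; and the generator attached to
the identity of `G` is the unit of the monoid. The second clause is the usual convention for
interval monoids: the relations `h = f g` never involve the empty word, so that without it the
generator attached to `1` would be an idempotent different from the unit. -/
inductive IntervalRel (gen : A → G) (w : G) :
    FreeMonoid (interval gen w) → FreeMonoid (interval gen w) → Prop
  | mul (h f g : interval gen w) (hmul : (h : G) = (f : G) * (g : G))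
      (hlen : len gen (h : G) = len gen (f : G) + len gen (g : G)) :
      IntervalRel gen w (FreeMonoid.of h) (FreeMonoid.of f * FreeMonoid.of g)
  | one (u : interval gen w) (hu : (u : G) = 1) :
      IntervalRel gen w (FreeMonoid.of u) 1

/-- The interval monoid `M([1, w])`. -/
abbrev IntervalMonoid (gen : A → G) (w : G) : Type _ :=
  PresentedMonoid (IntervalRel gen w)

end General

/-! ## The complex reflection group `G(e,e,n)` -/

/-- The monomial matrix whose nonzero entry in row `i` is `d i`, in column `σ i`. -/
def monomialMatrix {n : ℕ} (σ : Equiv.Perm (Fin n)) (d : Fin n → ℂ) :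
    Matrix (Fin n) (Fin n) ℂ :=
  Matrix.of fun i j => if j = σ i then d i else 0

lemma monomialMatrix_mul {n : ℕ} (σ τ : Equiv.Perm (Fin n)) (d f : Fin n → ℂ) :
    monomialMatrix σ d * monomialMatrix τ f
      = monomialMatrix (τ * σ) (fun i => d i * f (σ i)) := by
  ext i j
  rw [Matrix.mul_apply, Finset.sum_eq_single (σ i)]
  · simp only [monomialMatrix, Matrix.of_apply, if_true, mul_ite, mul_zero]
    rfl
  · intro b _ hb
    simp [monomialMatrix, hb]
  · simp

lemma monomialMatrix_one {n : ℕ} :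
    monomialMatrix (1 : Equiv.Perm (Fin n)) (fun _ => 1) = 1 := by
  ext i j
  simp [monomialMatrix, Matrix.one_apply, eq_comm]

/-- The entries of `d`, which are `e`-th roots of unity, as complex numbers. -/
def rootVal {e n : ℕ} (d : Fin n → rootsOfUnity e ℂ) : Fin n → ℂ :=
  fun i => ((d i : ℂˣ) : ℂ)

/-- `G(e,e,n)`: the group of `n × n` monomial matrices whose nonzero entries are `e`-th roots
of unity with product `1`. -/
def Geen (e n : ℕ) : Subgroup (Matrix.GeneralLinearGroup (Fin n) ℂ) where
  carrier := {g | ∃ (σ : Equiv.Perm (Fin n)) (d : Fin n → rootsOfUnity e ℂ),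
    ∏ i, d i = 1 ∧ (g : Matrix (Fin n) (Fin n) ℂ) = monomialMatrix σ (rootVal d)}
  mul_mem' := by
    rintro a b ⟨σ, d, hd, ha⟩ ⟨τ, f, hf, hb⟩
    refine ⟨τ * σ, fun i => d i * f (σ i), ?_, ?_⟩
    · rw [Finset.prod_mul_distrib, hd, Equiv.prod_comp σ f, hf, one_mul]
    · rw [Matrix.GeneralLinearGroup.coe_mul, ha, hb, monomialMatrix_mul]
      rfl
  one_mem' := by
    refine ⟨1, fun _ => 1, by simp, ?_⟩
    rw [Matrix.GeneralLinearGroup.coe_one, ← monomialMatrix_one]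
    rfl
  inv_mem' := by
    rintro a ⟨σ, d, hd, ha⟩
    refine ⟨σ⁻¹, fun i => (d (σ⁻¹ i))⁻¹, ?_, ?_⟩
    · rw [Finset.prod_inv_distrib, Equiv.prod_comp σ⁻¹ d, hd, inv_one]
    · rw [Matrix.coe_units_inv, ha]
      apply Matrix.inv_eq_right_inv
      rw [monomialMatrix_mul, ← monomialMatrix_one]
      simp [rootVal]

/-- The element of `G(e,e,n)` with matrix `monomialMatrix σ d`. -/
def mkGeen {e n : ℕ} (σ : Equiv.Perm (Fin n)) (d : Fin n → rootsOfUnity e ℂ)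
    (hd : ∏ i, d i = 1) : Geen e n :=
  ⟨⟨monomialMatrix σ (rootVal d),
    monomialMatrix σ⁻¹ (rootVal fun i => (d (σ⁻¹ i))⁻¹),
    by rw [monomialMatrix_mul, ← monomialMatrix_one]; simp [rootVal],
    by rw [monomialMatrix_mul, ← monomialMatrix_one]; simp [rootVal]⟩,
    σ, d, hd, rfl⟩

/-- The element `t_i` of `G(e,e,n)`: the matrix with upper left block
`(0, ζ^(-i); ζ^i, 0)`, completed by the identity. -/
def tElt {e n : ℕ} (hn : 2 ≤ n) (ζ : rootsOfUnity e ℂ) (i : ZMod e) : Geen e n :=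
  mkGeen (Equiv.swap ⟨0, by omega⟩ ⟨1, by omega⟩)
    (fun r => if r.val = 0 then (ζ ^ i.val)⁻¹ else if r.val = 1 then ζ ^ i.val else 1)
    (by
      obtain ⟨m, rfl⟩ : ∃ m, n = m + 2 := ⟨n - 2, by omega⟩
      simp [Fin.prod_univ_succ])

/-- The element `s_j` of `G(e,e,n)`, `3 ≤ j ≤ n`: the permutation matrix of the transposition
of the coordinates `j - 1` and `j` (numbered from `1` to `n`). -/
def sElt {n : ℕ} (e : ℕ) (j : ℕ) (h3 : 3 ≤ j) (hj : j ≤ n) : Geen e n :=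
  mkGeen (Equiv.swap ⟨j - 2, by omega⟩ ⟨j - 1, by omega⟩) (fun _ => 1) (by simp)

/-- The element `λ = diag(ζ^(-(n-1)), ζ, …, ζ)` of `G(e,e,n)`. -/
def lambdaElt {e n : ℕ} (hn : 2 ≤ n) (ζ : rootsOfUnity e ℂ) : Geen e n :=
  mkGeen 1 (fun r => if r.val = 0 then (ζ ^ (n - 1))⁻¹ else ζ)
    (by
      obtain ⟨m, rfl⟩ : ∃ m, n = m + 2 := ⟨n - 2, by omega⟩
      simp [Fin.prod_univ_succ, pow_succ])

/-- The alphabet `{t_0, …, t_{e-1}, s_3, …, s_n}`, the `t_i` being indexed by `ℤ/eℤ`. -/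
inductive Letter (e n : ℕ) : Type
  | t (i : ZMod e) : Letter e n
  | s (j : ℕ) (h3 : 3 ≤ j) (hj : j ≤ n) : Letter e n

/-- The element of `G(e,e,n)` a letter stands for. -/
def letterElt {e n : ℕ} (hn : 2 ≤ n) (ζ : rootsOfUnity e ℂ) : Letter e n → Geen e n
  | .t i => tElt hn ζ i
  | .s j h3 hj => sElt e j h3 hj

/-! ## The monoid `B^{⊕k}(e,e,n)` -/

open FreeMonoid in
/-- The defining relations of `B^{⊕k}(e,e,n)`. -/
inductive BRel (e n k : ℕ) : FreeMonoid (Letter e n) → FreeMonoid (Letter e n) → Prop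
  | braid_ss (i j : ℕ) (hi3 : 3 ≤ i) (hin : i ≤ n) (hj3 : 3 ≤ j) (hjn : j ≤ n)
      (hij : i + 1 = j ∨ j + 1 = i) :
      BRel e n k
        (of (.s i hi3 hin) * of (.s j hj3 hjn) * of (.s i hi3 hin))
        (of (.s j hj3 hjn) * of (.s i hi3 hin) * of (.s j hj3 hjn))
  | comm_ss (i j : ℕ) (hi3 : 3 ≤ i) (hin : i ≤ n) (hj3 : 3 ≤ j) (hjn : j ≤ n)
      (hij : i + 1 < j ∨ j + 1 < i) :
      BRel e n k
        (of (.s i hi3 hin) * of (.s j hj3 hjn))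
        (of (.s j hj3 hjn) * of (.s i hi3 hin))
  | braid_st (h3n : 3 ≤ n) (i : ZMod e) :
      BRel e n k
        (of (.s 3 le_rfl h3n) * of (.t i) * of (.s 3 le_rfl h3n))
        (of (.t i) * of (.s 3 le_rfl h3n) * of (.t i))
  | comm_st (j : ℕ) (hj4 : 4 ≤ j) (hjn : j ≤ n) (i : ZMod e) :
      BRel e n k
        (of (.s j (by omega) hjn) * of (.t i))
        (of (.t i) * of (.s j (by omega) hjn))
  | dual_tt (i j : ZMod e) :
      BRel e n k
        (of (.t i) * of (.t (i - (k : ZMod e))))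
        (of (.t j) * of (.t (j - (k : ZMod e))))

/-- The monoid `B^{⊕k}(e,e,n)`. -/
abbrev BMonoid (e n k : ℕ) : Type :=
  PresentedMonoid (BRel e n k)

/-- The element `x̃_1 ⋯ x̃_r` of `B^{⊕k}(e,e,n)` given by a word `x_1 ⋯ x_r`. -/
def BMonoid.ofWord {e n : ℕ} (k : ℕ) (l : List (Letter e n)) : BMonoid e n k :=
  (l.map (PresentedMonoid.of (BRel e n k))).prod

end IntervalStructure

namespace IntervalStructure

/-! ## Reduced expressions and interval monoids in general -/

section Words

variable {G A : Type*} [Group G] {gen : A → G}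

/-! The length on G(e,e,n) is an explicit sum over pairs of rows j < i: an inverted pair (the entry
of row i lies left of that of row j) costs 1, any other pair costs 0 or 2 according to whether the
entry of row i is 1. A letter exchanges two adjacent rows and affects the cost of that pair only,
always by exactly 1, and every g ≠ 1 has a letter that lowers the sum. By `len_eq_of_descent` the
sum is the word length, and its descents can be read off the matrix.

The element λ^k costs 2 on every pair. Adding the costs of w and of λ^(-k) w pair by pair shows that
w lies in [1, λ^k] exactly when every entry of a row i that occurs in a non-inverted pair j < i is 1
or ζ^k (`mem_interval_lambdaElt_pow_iff`).

What remains is an argument in the style of Matsumoto's theorem (`prod_eq_of_isReducedExpression`):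
it suffices that two descents x, y of some w in the interval extend to the two sides of a defining
relation, both reduced prefixes of w (`exists_common_reducedPrefix`). Braid and commutation
relations do this for every w. For distinct t_i, t_j the first two rows must be non-inverted with
second entry different from 1; membership in the interval makes that entry ζ^k, and then t_i must be
followed by t_{i-k}. Conversely all sides of relations are reduced prefixes of λ^k, so reduced
expressions give mutually inverse maps between the two monoids. -/

lemma len_le_length {l : List A} {w : G} (h : Represents gen l w) : len gen w ≤ l.length :=
  Nat.sInf_le ⟨l, rfl, h⟩

lemma exists_isReducedExpression {w : G} (h : ∃ l, Represents gen l w) :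
    ∃ l, IsReducedExpression gen l w := by
  obtain ⟨l, hl⟩ := h
  obtain ⟨l', h1, h2⟩ := Nat.sInf_mem
    (s := {r : ℕ | ∃ l : List A, l.length = r ∧ Represents gen l w}) ⟨_, l, rfl, hl⟩
  exact ⟨l', h2, h1⟩

lemma len_one : len gen (1 : G) = 0 :=
  Nat.le_zero.1 (len_le_length (l := []) rfl)

lemma Represents.append {l l' : List A} {w w' : G} (h : Represents gen l w)
    (h' : Represents gen l' w') : Represents gen (l ++ l') (w * w') := by
  unfold Represents at *
  rw [List.map_append, List.prod_append, h, h']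

/-- As the letters are involutions, reversing a word inverts the element it represents. -/
lemma len_inv (hinv : ∀ x, gen x * gen x = 1) (w : G) : len gen w⁻¹ = len gen w := by
  have key : ∀ l w, Represents gen l w → Represents gen l.reverse w⁻¹ := by
    rintro l _ rfl
    unfold Represents
    rw [List.prod_inv_reverse, List.map_map, List.map_reverse]
    congr 3
    ext x
    exact eq_inv_of_mul_eq_one_left (hinv x)
  unfold len
  congr 1
  ext r
  constructor
  · rintro ⟨l, hl, h⟩
    exact ⟨l.reverse, by simpa using hl, by simpa using key _ _ h⟩
  · rintro ⟨l, hl, h⟩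
    exact ⟨l.reverse, by simpa using hl, key _ _ h⟩

lemma len_mul_le (hgen : ∀ g : G, ∃ l, Represents gen l g) (g h : G) :
    len gen (g * h) ≤ len gen g + len gen h := by
  obtain ⟨l, hl, hl'⟩ := exists_isReducedExpression (hgen g)
  obtain ⟨m, hm, hm'⟩ := exists_isReducedExpression (hgen h)
  rw [← hl', ← hm', ← List.length_append]
  exact len_le_length (hl.append hm)

/-- A function that vanishes at `1`, grows by at most one under left multiplication by a
generator, and decreases under some generator away from `1`, is the length. -/
theorem len_eq_of_descent (L : G → ℕ) (h1 : L 1 = 0) (hle : ∀ x g, L (gen x * g) ≤ L g + 1)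
    (hinv : ∀ x, gen x * gen x = 1) (hdesc : ∀ g ≠ 1, ∃ x, L (gen x * g) + 1 = L g) :
    (∀ g, ∃ l, Represents gen l g) ∧ ∀ g, len gen g = L g := by
  have key : ∀ m g, L g = m → ∃ l, l.length = m ∧ Represents gen l g := by
    intro m
    induction m with
    | zero =>
      intro g hg
      refine ⟨[], rfl, ?_⟩
      by_contra hne
      obtain ⟨x, hx⟩ := hdesc g (fun h => hne (by simp [Represents, h]))
      omega
    | succ m ih =>
      intro g hg
      obtain ⟨x, hx⟩ := hdesc g (fun h => by rw [h, h1] at hg; omega)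
      obtain ⟨l, hl, hl'⟩ := ih (gen x * g) (by omega)
      refine ⟨x :: l, by simp [hl], ?_⟩
      unfold Represents at *
      rw [List.map_cons, List.prod_cons, hl', ← mul_assoc, hinv, one_mul]
  have low : ∀ l : List A, ∀ g, Represents gen l g → L g ≤ l.length := by
    intro l
    induction l with
    | nil =>
      intro g hg
      have : g = 1 := by simpa [Represents] using hg.symm
      simp [this, h1]
    | cons x l ih =>
      intro g hg
      unfold Represents at hg
      rw [← hg, List.map_cons, List.prod_cons]
      exact (hle _ _).trans (by simpa using ih _ rfl)
  refine ⟨fun g => ?_, fun g => ?_⟩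
  · obtain ⟨l, -, hl⟩ := key _ g rfl
    exact ⟨l, hl⟩
  · obtain ⟨l, hl, hl'⟩ := key _ g rfl
    obtain ⟨m, hm, hm'⟩ := exists_isReducedExpression ⟨l, hl'⟩
    exact le_antisymm (hl ▸ len_le_length hl') (hm' ▸ low m g hm)

variable (gen) in
/-- The word `u` can be split off on the left of `w` without loss of length. -/
def IsReducedPrefix (u : List A) (w : G) : Prop :=
  len gen w = u.length + len gen ((u.map gen).prod⁻¹ * w)

lemma IsReducedPrefix.cons {x : A} {u : List A} {w : G} (hx : IsReducedPrefix gen [x] w)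
    (hu : IsReducedPrefix gen u ((gen x)⁻¹ * w)) : IsReducedPrefix gen (x :: u) w := by
  simp only [IsReducedPrefix, List.map_cons, List.map_nil, List.prod_cons, List.prod_nil, mul_one,
    List.length_cons, List.length_nil, mul_inv_rev, mul_assoc] at *
  omega

lemma IsReducedPrefix.append {u z : List A} {w : G} (h : IsReducedPrefix gen u w)
    (hz : IsReducedExpression gen z ((u.map gen).prod⁻¹ * w)) :
    IsReducedExpression gen (u ++ z) w := by
  obtain ⟨hz1, hz2⟩ := hz
  unfold IsReducedPrefix at h
  unfold Represents at hz1
  refine ⟨?_, by simp; omega⟩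
  unfold Represents
  rw [List.map_append, List.prod_append, hz1, mul_inv_cancel_left]

lemma IsReducedExpression.head (hgen : ∀ g : G, ∃ l, Represents gen l g) {x : A} {l : List A}
    {w : G} (h : IsReducedExpression gen (x :: l) w) :
    IsReducedPrefix gen [x] w ∧ IsReducedExpression gen l ((gen x)⁻¹ * w) := by
  obtain ⟨h1, h2⟩ := h
  have hl : Represents gen l ((gen x)⁻¹ * w) := by
    unfold Represents at *
    rw [← h1, List.map_cons, List.prod_cons, inv_mul_cancel_left]
  have h3 := len_le_length hl
  have h4 := len_mul_le hgen (gen x) ((gen x)⁻¹ * w)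
  have h5 : len gen (gen x) ≤ 1 := len_le_length (l := [x]) (by simp [Represents])
  rw [mul_inv_cancel_left] at h4
  simp only [List.length_cons] at h2
  refine ⟨?_, hl, by omega⟩
  simp [IsReducedPrefix]
  omega

lemma IsReducedPrefix.isReducedExpression (hgen : ∀ g : G, ∃ l, Represents gen l g)
    {u : List A} {w : G} (h : IsReducedPrefix gen u w) :
    IsReducedExpression gen u (u.map gen).prod := by
  refine ⟨rfl, le_antisymm ?_ (len_le_length rfl)⟩
  have h4 := len_mul_le hgen (u.map gen).prod ((u.map gen).prod⁻¹ * w)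
  rw [mul_inv_cancel_left] at h4
  unfold IsReducedPrefix at h
  omega

/-- The condition that 1 divides f is automatic, and the cofactor of f in w is forced. -/
lemma mem_interval_iff {f w : G} : f ∈ interval gen w ↔ len gen w = len gen f + len gen (f⁻¹ * w) := by
  constructor
  · rintro ⟨-, h, rfl, h'⟩
    simpa using h'
  · intro h
    exact ⟨⟨f, by simp, by simp [len_one]⟩, _, by simp, h⟩

lemma IsReducedPrefix.mem_interval (hgen : ∀ g : G, ∃ l, Represents gen l g)
    {u : List A} {w : G} (h : IsReducedPrefix gen u w) : (u.map gen).prod ∈ interval gen w := by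
  rw [mem_interval_iff, ← (h.isReducedExpression hgen).2]
  exact h

/-- If any two one-letter reduced prefixes can be completed to reduced prefixes with the same
value under `f`, then `f` takes the same value on all reduced expressions. -/
theorem prod_eq_of_isReducedExpression (hgen : ∀ g : G, ∃ l, Represents gen l g)
    {N : Type*} [Monoid N] (f : A → N) (I : Set G)
    (hI : ∀ w ∈ I, ∀ x, IsReducedPrefix gen [x] w → (gen x)⁻¹ * w ∈ I)
    (hloc : ∀ w ∈ I, ∀ x y, IsReducedPrefix gen [x] w → IsReducedPrefix gen [y] w →
      ∃ u v, IsReducedPrefix gen (x :: u) w ∧ IsReducedPrefix gen (y :: v) w ∧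
        ((x :: u).map gen).prod = ((y :: v).map gen).prod ∧
        ((x :: u).map f).prod = ((y :: v).map f).prod)
    {w : G} (hw : w ∈ I) {l l' : List A} (hl : IsReducedExpression gen l w)
    (hl' : IsReducedExpression gen l' w) : (l.map f).prod = (l'.map f).prod := by
  obtain ⟨r, hr⟩ : ∃ r, l.length = r := ⟨_, rfl⟩
  induction r generalizing l l' w with
  | zero =>
    have h' : l'.length = 0 := by rw [hl'.2, ← hl.2, hr]
    rw [List.length_eq_zero_iff.1 h', List.length_eq_zero_iff.1 hr]
  | succ r ih =>
    have hr' : l'.length = r + 1 := by rw [hl'.2, ← hl.2, hr]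
    obtain ⟨x, l, rfl⟩ := List.exists_cons_of_length_eq_add_one hr
    obtain ⟨y, m, rfl⟩ := List.exists_cons_of_length_eq_add_one hr'
    obtain ⟨hx, hl1⟩ := hl.head hgen
    obtain ⟨hy, hm1⟩ := hl'.head hgen
    obtain ⟨u, v, hu, hv, huv, huvf⟩ := hloc w hw x y hx hy
    -- One remainder `z` completes both prefixes. Induction compares the tails after `x`, then those
    -- after `y`; the local hypothesis links the two completed words.
    obtain ⟨z, hz⟩ := exists_isReducedExpression (hgen (((x :: u).map gen).prod⁻¹ * w))
    have h1 : IsReducedExpression gen (u ++ z) _ := ((hu.append hz).head hgen).2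
    have h2 : IsReducedExpression gen (v ++ z) _ := ((hv.append (huv ▸ hz)).head hgen).2
    have e1 := ih (hI w hw x hx) hl1 h1 (by simpa using hr)
    have e2 := ih (hI w hw y hy) hm1 h2 (by simpa using hr')
    rw [List.map_cons, List.prod_cons, e1, List.map_cons, List.prod_cons, e2]
    simp only [List.map_append, List.prod_append, ← mul_assoc]
    simp only [List.map_cons, List.prod_cons] at huvf
    rw [huvf]

/-- In the interval monoid, a reduced expression of an element of the interval gives the
generator attached to that element. -/
lemma IntervalMonoid.prod_of_isReducedExpression (hgen : ∀ g : G, ∃ l, Represents gen l g) {c : G}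
    (hI : ∀ w ∈ interval gen c, ∀ x, IsReducedPrefix gen [x] w →
      (gen x)⁻¹ * w ∈ interval gen c)
    (hX : ∀ x, gen x ∈ interval gen c) {w : G} (hw : w ∈ interval gen c) {l : List A}
    (hl : IsReducedExpression gen l w) :
    (l.map fun x => PresentedMonoid.of (IntervalRel gen c) ⟨gen x, hX x⟩).prod
      = PresentedMonoid.of (IntervalRel gen c) ⟨w, hw⟩ := by
  induction l generalizing w with
  | nil =>
    exact (PresentedMonoid.mk_eq_mk_of_rel (IntervalRel.one ⟨w, hw⟩ hl.1.symm)).symm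
  | cons x l ih =>
    obtain ⟨hx, hl1⟩ := hl.head hgen
    have hx1 : len gen (gen x) = 1 := by simpa using (hx.isReducedExpression hgen).2.symm
    rw [List.map_cons, List.prod_cons, ih (hI w hw x hx) hl1]
    refine (PresentedMonoid.mk_eq_mk_of_rel
      (IntervalRel.mul ⟨w, hw⟩ ⟨gen x, hX x⟩ ⟨_, hI w hw x hx⟩ (by simp) ?_)).symm
    simpa [IsReducedPrefix, hx1] using hx

/-- If a monoid is presented by the letters, with relations between reduced prefixes of `c` that
suffice to connect any two reduced expressions of an element of `[1, c]`, then it is the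
interval monoid of `[1, c]`. -/
theorem existsUnique_map_and_exists_mulEquiv_intervalMonoid
    (hgen : ∀ g : G, ∃ l, Represents gen l g) (R : FreeMonoid A → FreeMonoid A → Prop) (c : G)
    (hI : ∀ w ∈ interval gen c, ∀ x, IsReducedPrefix gen [x] w →
      (gen x)⁻¹ * w ∈ interval gen c)
    (hX : ∀ x, IsReducedPrefix gen [x] c)
    (hR : ∀ a b, R a b → IsReducedPrefix gen a.toList c ∧ IsReducedPrefix gen b.toList c ∧
      (a.toList.map gen).prod = (b.toList.map gen).prod)
    (hloc : ∀ w ∈ interval gen c, ∀ x y, IsReducedPrefix gen [x] w → IsReducedPrefix gen [y] w →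
      ∃ u v, IsReducedPrefix gen (x :: u) w ∧ IsReducedPrefix gen (y :: v) w ∧
        ((x :: u).map gen).prod = ((y :: v).map gen).prod ∧
        ((x :: u).map (PresentedMonoid.of R)).prod
          = ((y :: v).map (PresentedMonoid.of R)).prod) :
    (∃! F : interval gen c → PresentedMonoid R,
      ∀ (w : interval gen c) (l : List A), IsReducedExpression gen l (w : G) →
        F w = (l.map (PresentedMonoid.of R)).prod) ∧
    ∃ φ : PresentedMonoid R ≃* IntervalMonoid gen c, ∀ x, ∃ hx : gen x ∈ interval gen c,
      φ (PresentedMonoid.of R x) = PresentedMonoid.of (IntervalRel gen c) ⟨gen x, hx⟩ := by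
  have hX' : ∀ x, gen x ∈ interval gen c := fun x => by
    simpa using (hX x).mem_interval hgen
  choose red hred using fun g => exists_isReducedExpression (hgen g)
  let F : interval gen c → PresentedMonoid R :=
    fun w => ((red w).map (PresentedMonoid.of R)).prod
  have hF : ∀ (w : interval gen c) (l : List A), IsReducedExpression gen l (w : G) →
      F w = (l.map (PresentedMonoid.of R)).prod := fun w l hl =>
    prod_eq_of_isReducedExpression hgen _ _ hI hloc w.2 (hred _) hl
  refine ⟨⟨F, hF, fun F' hF' => funext fun w => ?_⟩, ?_⟩
  · rw [hF' w _ (hred w)]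
  let φ : PresentedMonoid R →* IntervalMonoid gen c :=
    PresentedMonoid.lift (fun x => PresentedMonoid.of (IntervalRel gen c) ⟨gen x, hX' x⟩) (by
      intro a b hab
      obtain ⟨ha, hb, h⟩ := hR a b hab
      have hb' := hb.isReducedExpression hgen
      rw [← h] at hb'
      rw [FreeMonoid.lift_apply, FreeMonoid.lift_apply,
        IntervalMonoid.prod_of_isReducedExpression hgen hI hX' (ha.mem_interval hgen)
          (ha.isReducedExpression hgen),
        IntervalMonoid.prod_of_isReducedExpression hgen hI hX' (ha.mem_interval hgen) hb'])
  let ψ : IntervalMonoid gen c →* PresentedMonoid R :=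
    PresentedMonoid.lift F (by
      rintro _ _ (⟨h, f, g, hmul, hlen⟩ | ⟨u, hu⟩)
      · simp only [FreeMonoid.lift_eval_of, map_mul]
        -- Additivity of lengths is exactly what keeps the concatenation reduced.
        have : IsReducedExpression gen (red f ++ red g) (h : G) := by
          refine ⟨?_, ?_⟩
          · rw [hmul]; exact (hred f).1.append (hred g).1
          · rw [List.length_append, (hred f).2, (hred g).2, hlen]
        rw [hF h _ this, List.map_append, List.prod_append]
      · simp only [FreeMonoid.lift_eval_of, map_one]
        exact hF u [] ⟨by simp [Represents, hu], by simp [hu, len_one]⟩)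
  refine ⟨MonoidHom.toMulEquiv φ ψ ?_ ?_, fun x => ⟨hX' x, ?_⟩⟩
  · ext x
    simp only [MonoidHom.comp_apply, MonoidHom.id_apply, φ, ψ, PresentedMonoid.lift_of]
    rw [hF _ [x] (by simpa using (hX x).isReducedExpression hgen)]
    simp
  · ext w
    simp only [MonoidHom.comp_apply, MonoidHom.id_apply, ψ, PresentedMonoid.lift_of]
    rw [← IntervalMonoid.prod_of_isReducedExpression hgen hI hX' w.2 (hred w)]
    simp only [F, map_list_prod, List.map_map]
    rfl
  · rfl

end Words

/-! ## Coordinates on `G(e,e,n)` -/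

section Coordinates

variable {e n : ℕ}

/-- The entries indexed by `d` are units, hence nonzero, so the support determines the permutation.
This makes the chosen coordinates `perm` and `coef` canonical. -/
lemma monomialMatrix_rootVal_inj {σ τ : Equiv.Perm (Fin n)} {d f : Fin n → rootsOfUnity e ℂ}
    (h : monomialMatrix σ (rootVal d) = monomialMatrix τ (rootVal f)) : σ = τ ∧ d = f := by
  have hst : ∀ i, σ i = τ i ∧ d i = f i := by
    intro i
    have hi := congrFun (congrFun h i) (σ i)
    simp only [monomialMatrix, Matrix.of_apply, if_true] at hi
    split_ifs at hi with h1
    · exact ⟨h1, Subtype.ext (Units.ext hi)⟩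
    · exact absurd hi (Units.ne_zero _)
  exact ⟨Equiv.ext fun i => (hst i).1, funext fun i => (hst i).2⟩

/-- The column of the nonzero entry in each row. -/
noncomputable def perm (g : Geen e n) : Equiv.Perm (Fin n) := g.2.choose

/-- The nonzero entry in each row. -/
noncomputable def coef (g : Geen e n) : Fin n → rootsOfUnity e ℂ := g.2.choose_spec.choose

lemma prod_coef (g : Geen e n) : ∏ i, coef g i = 1 := g.2.choose_spec.choose_spec.1

lemma coe_eq_monomialMatrix (g : Geen e n) :
    (g.1 : Matrix (Fin n) (Fin n) ℂ) = monomialMatrix (perm g) (rootVal (coef g)) :=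
  g.2.choose_spec.choose_spec.2

lemma perm_mkGeen (σ : Equiv.Perm (Fin n)) (d : Fin n → rootsOfUnity e ℂ) (hd : ∏ i, d i = 1) :
    perm (mkGeen σ d hd) = σ :=
  (monomialMatrix_rootVal_inj (coe_eq_monomialMatrix (mkGeen σ d hd)).symm).1

lemma coef_mkGeen (σ : Equiv.Perm (Fin n)) (d : Fin n → rootsOfUnity e ℂ) (hd : ∏ i, d i = 1) :
    coef (mkGeen σ d hd) = d :=
  (monomialMatrix_rootVal_inj (coe_eq_monomialMatrix (mkGeen σ d hd)).symm).2

lemma Geen.ext_perm_coef {g h : Geen e n} (h1 : ∀ r, perm g r = perm h r)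
    (h2 : ∀ r, coef g r = coef h r) : g = h := by
  apply Subtype.ext
  apply Units.ext
  rw [coe_eq_monomialMatrix, coe_eq_monomialMatrix, Equiv.ext h1, funext h2]

lemma perm_coef_mul (g h : Geen e n) :
    perm (g * h) = perm h * perm g ∧ coef (g * h) = fun i => coef g i * coef h (perm g i) := by
  apply monomialMatrix_rootVal_inj
  rw [← coe_eq_monomialMatrix, Subgroup.coe_mul, Matrix.GeneralLinearGroup.coe_mul,
    coe_eq_monomialMatrix g, coe_eq_monomialMatrix h, monomialMatrix_mul]
  rfl

lemma perm_mul (g h : Geen e n) (r : Fin n) : perm (g * h) r = perm h (perm g r) := by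
  rw [(perm_coef_mul g h).1]; rfl

lemma coef_mul (g h : Geen e n) (r : Fin n) :
    coef (g * h) r = coef g r * coef h (perm g r) := by
  rw [(perm_coef_mul g h).2]

lemma perm_coef_one : perm (1 : Geen e n) = 1 ∧ coef (1 : Geen e n) = fun _ => 1 := by
  apply monomialMatrix_rootVal_inj
  rw [← coe_eq_monomialMatrix, Subgroup.coe_one, Matrix.GeneralLinearGroup.coe_one,
    ← monomialMatrix_one]
  rfl

lemma perm_one (r : Fin n) : perm (1 : Geen e n) r = r := by rw [perm_coef_one.1]; rfl

lemma coef_one (r : Fin n) : coef (1 : Geen e n) r = 1 := by rw [perm_coef_one.2]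

/-! ## The action of the letters -/

namespace Letter

/-- The index, counted from `0`, of the first of the two rows that a letter exchanges. -/
def pos : Letter e n → ℕ
  | .t _ => 0
  | .s j _ _ => j - 2

/-- The scalar by which a letter multiplies the first of the two rows it exchanges. -/
def scalar (ζ : rootsOfUnity e ℂ) : Letter e n → rootsOfUnity e ℂ
  | .t i => ζ ^ i.val
  | .s _ _ _ => 1

lemma pos_add_one_lt (hn : 2 ≤ n) (x : Letter e n) : x.pos + 1 < n := by
  cases x <;> simp only [pos] <;> omega

/-- The first of the two rows that a letter exchanges. -/
def lo (hn : 2 ≤ n) (x : Letter e n) : Fin n := ⟨x.pos, by have := x.pos_add_one_lt hn; omega⟩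

/-- The second of the two rows that a letter exchanges. -/
def hi (hn : 2 ≤ n) (x : Letter e n) : Fin n := ⟨x.pos + 1, x.pos_add_one_lt hn⟩

lemma scalar_eq_one (ζ : rootsOfUnity e ℂ) {x : Letter e n} (hx : x.pos ≠ 0) :
    x.scalar ζ = 1 := by
  cases x with
  | t i => exact absurd rfl hx
  | s => rfl

end Letter

open Letter

variable (hn : 2 ≤ n) (ζ : rootsOfUnity e ℂ)

@[simp] lemma val_lo (x : Letter e n) : (x.lo hn).val = x.pos := rfl

@[simp] lemma val_hi (x : Letter e n) : (x.hi hn).val = x.pos + 1 := rfl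

lemma lo_ne_hi (x : Letter e n) : x.lo hn ≠ x.hi hn := by
  simp [Fin.ext_iff]

lemma hi_ne_lo (x : Letter e n) : x.hi hn ≠ x.lo hn := (lo_ne_hi hn x).symm

lemma perm_letterElt (x : Letter e n) :
    perm (letterElt hn ζ x) = Equiv.swap (x.lo hn) (x.hi hn) := by
  cases x with
  | t i => rw [letterElt, tElt, perm_mkGeen]; rfl
  | s j h3 hj =>
    rw [letterElt, sElt, perm_mkGeen]
    congr 1
    simp only [hi, pos, Fin.mk.injEq]
    omega

lemma coef_letterElt (x : Letter e n) (r : Fin n) :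
    coef (letterElt hn ζ x) r
      = if r = x.lo hn then (x.scalar ζ)⁻¹ else if r = x.hi hn then x.scalar ζ else 1 := by
  cases x with
  | t i =>
    rw [letterElt, tElt, coef_mkGeen]
    simp only [lo, hi, pos, Fin.ext_iff, scalar, zero_add]
  | s j h3 hj =>
    rw [letterElt, sElt, coef_mkGeen]
    simp [scalar]

lemma perm_letter_mul (x : Letter e n) (g : Geen e n) (r : Fin n) :
    perm (letterElt hn ζ x * g) r = perm g (Equiv.swap (x.lo hn) (x.hi hn) r) := by
  rw [perm_mul, perm_letterElt]

lemma perm_letter_mul' (x : Letter e n) (g : Geen e n) (r : Fin n) :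
    perm (letterElt hn ζ x * g) r
      = if r = x.lo hn then perm g (x.hi hn) else if r = x.hi hn then perm g (x.lo hn)
        else perm g r := by
  rw [perm_letter_mul, Equiv.swap_apply_def]
  split_ifs <;> rfl

lemma coef_letter_mul (x : Letter e n) (g : Geen e n) (r : Fin n) :
    coef (letterElt hn ζ x * g) r
      = if r = x.lo hn then (x.scalar ζ)⁻¹ * coef g (x.hi hn)
        else if r = x.hi hn then x.scalar ζ * coef g (x.lo hn) else coef g r := by
  rw [coef_mul, coef_letterElt, perm_letterElt, Equiv.swap_apply_def]
  split_ifs <;> simp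

lemma letterElt_mul_self (x : Letter e n) : letterElt hn ζ x * letterElt hn ζ x = 1 := by
  apply Geen.ext_perm_coef <;> intro r
  · rw [perm_letter_mul, perm_letterElt, Equiv.swap_apply_self, perm_one]
  · rw [coef_letter_mul, coef_letterElt, coef_letterElt, coef_letterElt, coef_one]
    simp only [hi_ne_lo hn x, if_true, if_false]
    split_ifs <;> simp

lemma letterElt_inv (x : Letter e n) : (letterElt hn ζ x)⁻¹ = letterElt hn ζ x :=
  inv_eq_of_mul_eq_one_left (letterElt_mul_self hn ζ x)

/-! ## The length function -/

/-- The contribution of the rows `j < i` to the length. -/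
noncomputable def pairWeight (g : Geen e n) (j i : Fin n) : ℕ :=
  open Classical in if perm g i < perm g j then 1 else if coef g i = 1 then 0 else 2

/-- The sum of the contributions of all pairs of rows. -/
noncomputable def weight (g : Geen e n) : ℕ :=
  ∑ p : Fin n × Fin n with p.1 < p.2, pairWeight g p.1 p.2

/-- Left multiplication by `x` decreases the length of `g`. -/
def IsDescent (x : Letter e n) (g : Geen e n) : Prop :=
  (perm g (x.lo hn) < perm g (x.hi hn) ∧ coef g (x.hi hn) ≠ 1) ∨
    (perm g (x.hi hn) < perm g (x.lo hn) ∧ x.scalar ζ * coef g (x.lo hn) = 1)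

/-- The two exchanged rows are adjacent, so only their own order is reversed. -/
lemma swap_lt_swap {x : Letter e n} {j i : Fin n} (hji : j < i)
    (h : ¬ (j = x.lo hn ∧ i = x.hi hn)) :
    Equiv.swap (x.lo hn) (x.hi hn) j < Equiv.swap (x.lo hn) (x.hi hn) i := by
  simp only [Equiv.swap_apply_def]
  split_ifs <;> simp only [Fin.ext_iff, Fin.lt_def, val_lo, val_hi] at * <;> omega

/-- The scalars of `x` are invisible here: some t_i rescales only the first two rows, the first is
never the larger row of a pair and the second is so only in the excluded pair; every s_j has scalar
1. -/
lemma coef_letter_mul_of_lt {x : Letter e n} (g : Geen e n) {j i : Fin n} (hji : j < i)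
    (h : ¬ (j = x.lo hn ∧ i = x.hi hn)) :
    coef (letterElt hn ζ x * g) i = coef g (Equiv.swap (x.lo hn) (x.hi hn) i) := by
  by_cases hx : x.pos = 0
  · have h1 : i ≠ x.lo hn := by
      simp only [ne_eq, Fin.ext_iff, Fin.lt_def, val_lo, val_hi, hx] at *; omega
    have h2 : i ≠ x.hi hn := by
      simp only [ne_eq, Fin.ext_iff, Fin.lt_def, val_lo, val_hi, hx] at *; omega
    rw [coef_letter_mul, if_neg h1, if_neg h2, Equiv.swap_apply_of_ne_of_ne h1 h2]
  · rw [coef_letter_mul, scalar_eq_one ζ hx, Equiv.swap_apply_def]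
    split_ifs <;> simp

/-- The exchange of rows permutes the remaining pairs and preserves their contributions, so only the
exchanged pair counts. The additive form avoids subtraction in ℕ. -/
lemma weight_letter_mul (x : Letter e n) (g : Geen e n) :
    weight (letterElt hn ζ x * g) + pairWeight g (x.lo hn) (x.hi hn)
      = weight g + pairWeight (letterElt hn ζ x * g) (x.lo hn) (x.hi hn) := by
  have hmem : (x.lo hn, x.hi hn) ∈ ({p | p.1 < p.2} : Finset (Fin n × Fin n)) := by
    simp only [Finset.mem_filter, Finset.mem_univ, true_and, Fin.lt_def, val_lo, val_hi]
    omega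
  have hsum : ∑ p ∈ ({p | p.1 < p.2} : Finset (Fin n × Fin n)).erase (x.lo hn, x.hi hn),
        pairWeight (letterElt hn ζ x * g) p.1 p.2
      = ∑ p ∈ ({p | p.1 < p.2} : Finset (Fin n × Fin n)).erase (x.lo hn, x.hi hn),
        pairWeight g p.1 p.2 := by
    let s := Equiv.swap (x.lo hn) (x.hi hn)
    have hs : ∀ p ∈ ({p | p.1 < p.2} : Finset (Fin n × Fin n)).erase (x.lo hn, x.hi hn),
        (s p.1, s p.2) ∈ ({p | p.1 < p.2} : Finset (Fin n × Fin n)).erase (x.lo hn, x.hi hn) := by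
      rintro ⟨j, i⟩ hp
      simp only [Finset.mem_erase, Finset.mem_filter, Finset.mem_univ, true_and, ne_eq,
        Prod.mk.injEq] at hp ⊢
      refine ⟨?_, swap_lt_swap hn hp.2 hp.1⟩
      rintro ⟨h1, h2⟩
      rw [Equiv.swap_apply_eq_iff, Equiv.swap_apply_left] at h1
      rw [Equiv.swap_apply_eq_iff, Equiv.swap_apply_right] at h2
      have := hp.2
      simp only [h1, h2, Fin.lt_def, val_lo, val_hi] at this
      omega
    refine Finset.sum_bij' (fun p _ => (s p.1, s p.2)) (fun p _ => (s p.1, s p.2)) hs hs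
      (fun p _ => by simp [s]) (fun p _ => by simp [s]) ?_
    rintro ⟨j, i⟩ hp
    simp only [Finset.mem_erase, Finset.mem_filter, Finset.mem_univ, true_and, ne_eq,
      Prod.mk.injEq] at hp
    simp only [pairWeight, perm_letter_mul, coef_letter_mul_of_lt hn ζ g hp.2 hp.1, s]
  unfold weight
  rw [← Finset.add_sum_erase _ _ hmem, ← Finset.add_sum_erase _ (fun p => pairWeight g p.1 p.2) hmem,
    hsum]
  ring

lemma IsDescent.weight_add_one {x : Letter e n} {g : Geen e n} (h : IsDescent hn ζ x g) :
    weight (letterElt hn ζ x * g) + 1 = weight g := by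
  have key := weight_letter_mul hn ζ x g
  simp only [pairWeight, perm_letter_mul', coef_letter_mul, hi_ne_lo hn x, if_true,
    if_false] at key
  rcases h with ⟨h1, h2⟩ | ⟨h1, h2⟩
  · simp only [h1, h1.not_gt, h2, if_true, if_false] at key
    omega
  · simp only [h1, h1.not_gt, h2, if_true, if_false] at key
    omega

lemma weight_of_not_isDescent {x : Letter e n} {g : Geen e n} (h : ¬ IsDescent hn ζ x g) :
    weight (letterElt hn ζ x * g) = weight g + 1 := by
  have key := weight_letter_mul hn ζ x g
  simp only [pairWeight, perm_letter_mul', coef_letter_mul, hi_ne_lo hn x, if_true,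
    if_false] at key
  unfold IsDescent at h
  push Not at h
  rcases lt_or_gt_of_ne ((perm g).injective.ne (lo_ne_hi hn x)) with h1 | h1
  · simp only [h1, h1.not_gt, h.1 h1, if_true, if_false] at key
    omega
  · simp only [h1, h1.not_gt, h.2 h1, if_true, if_false] at key
    omega

lemma weight_one : weight (1 : Geen e n) = 0 := by
  unfold weight
  refine Finset.sum_eq_zero fun p hp => ?_
  simp only [Finset.mem_filter, Finset.mem_univ, true_and] at hp
  simp [pairWeight, perm_one, coef_one, hp.le]

/-! ### Existence of descents and the length formula -/

variable {ζ}

lemma exists_pow_val_eq [NeZero e] (hζ : IsPrimitiveRoot ζ e) (u : rootsOfUnity e ℂ) :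
    ∃ i : ZMod e, ζ ^ i.val = u := by
  have h1 : IsPrimitiveRoot ((ζ : ℂˣ) : ℂ) e :=
    IsPrimitiveRoot.coe_units_iff.2 (IsPrimitiveRoot.coe_submonoidClass_iff.2 hζ)
  have h2 : ((u : ℂˣ) : ℂ) ^ e = 1 := by
    rw [← Units.val_pow_eq_pow_val, (mem_rootsOfUnity e _).1 u.2, Units.val_one]
  obtain ⟨i, hi, h⟩ := h1.eq_pow_of_pow_eq_one h2
  refine ⟨(i : ZMod e), ?_⟩
  rw [ZMod.val_cast_of_lt hi]
  apply Subtype.ext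
  apply Units.ext
  simpa using h

/-- Without descents, consecutive rows are never inverted and all entries below the first row are 1.
The permutation is then the identity, and the product condition settles the first entry. -/
lemma exists_isDescent [NeZero e] (hζ : IsPrimitiveRoot ζ e) {g : Geen e n} (hg : g ≠ 1) :
    ∃ x, IsDescent hn ζ x g := by
  by_contra! hx
  apply hg
  have step : ∀ m (hm : m + 1 < n),
      perm g ⟨m, by omega⟩ < perm g ⟨m + 1, hm⟩ ∧ coef g ⟨m + 1, hm⟩ = 1 := by
    intro m
    induction m with
    | zero =>
      intro hm
      -- This t_i turns the first entry into 1, so it would be a descent if the first two rows were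
      -- inverted.
      obtain ⟨i, hi⟩ := exists_pow_val_eq hζ (coef g ⟨0, by omega⟩)⁻¹
      have h := hx (.t i)
      simp only [IsDescent, lo, Letter.hi, pos, scalar, hi, inv_mul_cancel, not_or, not_and, not_not,
        not_true_eq_false, imp_false, not_lt, zero_add] at h
      have h2 : perm g ⟨0, by omega⟩ < perm g ⟨1, hm⟩ :=
        lt_of_le_of_ne h.2 ((perm g).injective.ne (by simp))
      exact ⟨h2, h.1 h2⟩
    | succ m ih =>
      intro hm
      have h := hx (.s (m + 3) (by omega) (by omega))
      -- The entry of the upper row is already 1, so an inversion would make this s_j a descent.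
      obtain ⟨-, ih2⟩ := ih (by omega)
      simp only [IsDescent, lo, Letter.hi, pos, scalar, one_mul, not_or, not_and, not_not] at h
      have e1 : m + 3 - 2 = m + 1 := by omega
      simp only [e1, ih2, not_true_eq_false, imp_false, not_lt] at h
      have h2 := lt_of_le_of_ne h.2 ((perm g).injective.ne (by simp))
      exact ⟨h2, h.1 h2⟩
  have hmono : StrictMono (perm g) := by
    obtain ⟨m, rfl⟩ : ∃ m, n = m + 1 := ⟨n - 1, by omega⟩
    rw [Fin.strictMono_iff_lt_succ]
    exact fun i => (step i (by omega)).1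
  -- A finite chain has no order automorphism but the identity.
  have hperm : ∀ r, perm g r = r := fun r =>
    DFunLike.congr_fun (Subsingleton.elim (hmono.orderIsoOfSurjective _ (perm g).surjective)
      (OrderIso.refl _)) r
  have hcoef : ∀ r : Fin n, r ≠ ⟨0, by omega⟩ → coef g r = 1 := by
    rintro ⟨r, hr⟩ h0
    obtain ⟨m, rfl⟩ : ∃ m, r = m + 1 := ⟨r - 1, by simp at h0; omega⟩
    exact (step m hr).2
  refine Geen.ext_perm_coef (fun r => by rw [hperm, perm_one]) fun r => ?_
  rw [coef_one]
  by_cases hr : r = ⟨0, by omega⟩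
  · have := prod_coef g
    rwa [Finset.prod_eq_single ⟨0, by omega⟩ (fun b _ hb => hcoef b hb) (by simp), ← hr] at this
  · exact hcoef r hr

lemma represents_and_len [NeZero e] (hζ : IsPrimitiveRoot ζ e) :
    (∀ g : Geen e n, ∃ l, Represents (letterElt hn ζ) l g) ∧
      ∀ g : Geen e n, len (letterElt hn ζ) g = weight g :=
  len_eq_of_descent weight weight_one
    (fun x g => by
      by_cases h : IsDescent hn ζ x g
      · have := h.weight_add_one; omega
      · exact (weight_of_not_isDescent hn ζ h).le)
    (letterElt_mul_self hn ζ)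
    (fun g hg => (exists_isDescent hn hζ hg).imp fun x hx => hx.weight_add_one)

/-- A letter that is not a descent raises the length by one, so it cannot be split off. -/
lemma isReducedPrefix_singleton [NeZero e] (hζ : IsPrimitiveRoot ζ e) {x : Letter e n}
    {g : Geen e n} : IsReducedPrefix (letterElt hn ζ) [x] g ↔ IsDescent hn ζ x g := by
  simp only [IsReducedPrefix, List.map_cons, List.map_nil, List.prod_cons, List.prod_nil, mul_one,
    List.length_cons, List.length_nil, letterElt_inv, (represents_and_len hn hζ).2]
  constructor
  · intro h
    by_contra h'
    have := weight_of_not_isDescent hn ζ h'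
    omega
  · intro h
    have := h.weight_add_one
    omega

end Coordinates

section Interval

open Letter

variable {e n : ℕ} (hn : 2 ≤ n) {ζ : rootsOfUnity e ℂ}

/-! ## Elements of the interval -/

lemma perm_coef_lambdaElt_pow (k : ℕ) :
    (∀ r, perm (lambdaElt hn ζ ^ k) r = r) ∧
      ∀ r, coef (lambdaElt hn ζ ^ k) r = (if r.val = 0 then (ζ ^ (n - 1))⁻¹ else ζ) ^ k := by
  induction k with
  | zero => exact ⟨fun r => by rw [pow_zero, perm_one], fun r => by rw [pow_zero, coef_one, pow_zero]⟩
  | succ k ih =>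
    refine ⟨fun r => ?_, fun r => ?_⟩
    · rw [pow_succ, perm_mul, ih.1, lambdaElt, perm_mkGeen]; rfl
    · rw [pow_succ, coef_mul, ih.1, ih.2, lambdaElt, coef_mkGeen, pow_succ]

lemma coef_lambdaElt_pow_of_lt (k : ℕ) {j i : Fin n} (hji : j < i) :
    coef (lambdaElt hn ζ ^ k) i = ζ ^ k := by
  have : i.val ≠ 0 := by rw [Fin.lt_def] at hji; omega
  rw [(perm_coef_lambdaElt_pow hn k).2, if_neg this]

lemma mem_interval_lambdaElt_pow_iff [NeZero e] (hζ : IsPrimitiveRoot ζ e) {k : ℕ}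
    (hk : ζ ^ k ≠ 1) {w : Geen e n} :
    w ∈ interval (letterElt hn ζ) (lambdaElt hn ζ ^ k) ↔
      ∀ j i, j < i → perm w j < perm w i → coef w i = 1 ∨ coef w i = ζ ^ k := by
  classical
  set c := lambdaElt hn ζ ^ k with hc
  have hlen := (represents_and_len hn hζ).2
  have hperm : ∀ r, perm (c⁻¹ * w) r = perm w r := fun r => by
    rw [← (perm_coef_lambdaElt_pow hn (ζ := ζ) k).1 r, ← hc, ← perm_mul, mul_inv_cancel_left, hc,
      (perm_coef_lambdaElt_pow hn (ζ := ζ) k).1 r]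
  have hcoef : ∀ j i, j < i → coef w i = ζ ^ k * coef (c⁻¹ * w) i := fun j i hji => by
    conv_lhs => rw [← mul_inv_cancel_left c w, coef_mul, coef_lambdaElt_pow_of_lt hn k hji,
      (perm_coef_lambdaElt_pow hn k).1]
  have hwc : weight c = ∑ p : Fin n × Fin n with p.1 < p.2, 2 := by
    refine Finset.sum_congr rfl fun p hp => ?_
    have hp' : p.1 < p.2 := by simpa using hp
    simp [pairWeight, hc, (perm_coef_lambdaElt_pow hn k).1, hp'.le,
      coef_lambdaElt_pow_of_lt hn k hp', hk]
  -- An inverted pair contributes 1 + 1. For any other pair, the cost from w vanishes at entry 1 and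
  -- the cost from c⁻¹w at entry ζ^k; these values differ, so the total is 2 at either of them and 4
  -- elsewhere.
  have hsum : weight w + weight (c⁻¹ * w) = ∑ p : Fin n × Fin n with p.1 < p.2,
      (2 + if perm w p.1 < perm w p.2 ∧ ¬ (coef w p.2 = 1 ∨ coef w p.2 = ζ ^ k)
        then 2 else 0) := by
    unfold weight
    rw [← Finset.sum_add_distrib]
    refine Finset.sum_congr rfl fun p hp => ?_
    have hp' : p.1 < p.2 := by simpa using hp
    simp only [pairWeight, hperm, hcoef _ _ hp', mul_eq_left]
    rcases lt_or_gt_of_ne ((perm w).injective.ne hp'.ne) with h | h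
    · simp only [h, h.not_gt, if_false, true_and]
      by_cases h1 : coef (c⁻¹ * w) p.2 = 1
      · simp [h1, hk]
      · by_cases h2 : ζ ^ k * coef (c⁻¹ * w) p.2 = 1 <;> simp [h1, h2]
    · simp [h, h.not_gt]
  -- Inverting the cofactor w⁻¹c gives c⁻¹w, which has the permutation of w and rescaled rows.
  rw [mem_interval_iff, ← len_inv (letterElt_mul_self hn ζ) (w⁻¹ * c), mul_inv_rev, inv_inv,
    hlen, hlen, hlen, hsum, hwc, Finset.sum_add_distrib, left_eq_add, Finset.sum_eq_zero_iff]
  constructor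
  · intro h j i hji hw
    by_contra hbad
    simpa [hw, hbad] using h (j, i) (by simpa using hji)
  · intro h p hp
    rw [if_neg]
    rintro ⟨h1, h2⟩
    exact h2 (h _ _ (by simpa using hp) h1)

/-- Only the exchanged pair can violate the criterion anew. If it becomes non-inverted, it was
inverted in `w`, and being a descent forces the new lower entry to be 1. -/
lemma letterElt_mul_mem_interval [NeZero e] (hζ : IsPrimitiveRoot ζ e) {k : ℕ}
    (hk : ζ ^ k ≠ 1) {w : Geen e n}
    (hw : w ∈ interval (letterElt hn ζ) (lambdaElt hn ζ ^ k)) {x : Letter e n}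
    (hx : IsDescent hn ζ x w) :
    letterElt hn ζ x * w ∈ interval (letterElt hn ζ) (lambdaElt hn ζ ^ k) := by
  rw [mem_interval_lambdaElt_pow_iff hn hζ hk] at *
  intro j i hji hlt
  by_cases h : j = x.lo hn ∧ i = x.hi hn
  · obtain ⟨rfl, rfl⟩ := h
    simp only [perm_letter_mul', hi_ne_lo hn x, if_true, if_false] at hlt
    left
    rw [coef_letter_mul, if_neg (hi_ne_lo hn x), if_pos rfl]
    rcases hx with ⟨h1, -⟩ | ⟨-, h1⟩
    · exact absurd hlt h1.not_gt
    · exact h1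
  · rw [coef_letter_mul_of_lt hn ζ w hji h]
    rw [perm_letter_mul, perm_letter_mul] at hlt
    exact hw _ _ (swap_lt_swap hn hji h) hlt

lemma isDescent_lambdaElt_pow {k : ℕ} (hk : ζ ^ k ≠ 1) (x : Letter e n) :
    IsDescent hn ζ x (lambdaElt hn ζ ^ k) := by
  have h : x.lo hn < x.hi hn := by simp only [Fin.lt_def, val_lo, val_hi]; omega
  left
  rw [(perm_coef_lambdaElt_pow hn k).1, (perm_coef_lambdaElt_pow hn k).1,
    coef_lambdaElt_pow_of_lt hn k h]
  exact ⟨h, hk⟩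

/-! ## Reduced prefixes of two and three letters -/

lemma isReducedPrefix_cons [NeZero e] (hζ : IsPrimitiveRoot ζ e) {x : Letter e n}
    {u : List (Letter e n)} {w : Geen e n} (hx : IsDescent hn ζ x w)
    (hu : IsReducedPrefix (letterElt hn ζ) u (letterElt hn ζ x * w)) :
    IsReducedPrefix (letterElt hn ζ) (x :: u) w :=
  ((isReducedPrefix_singleton hn hζ).2 hx).cons (by rwa [letterElt_inv])

/-- Three consecutive rows are involved. Both words meet the three pairs of rows of `w`, in opposite
orders, so each step is a descent once the outer pair satisfies the descent condition too. -/
lemma braid_isReducedPrefix [NeZero e] (hζ : IsPrimitiveRoot ζ e) {x y : Letter e n}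
    (hxy : y.pos = x.pos + 1) {w : Geen e n} (hx : IsDescent hn ζ x w)
    (hy : IsDescent hn ζ y w) :
    IsReducedPrefix (letterElt hn ζ) [x, y, x] w ∧ IsReducedPrefix (letterElt hn ζ) [y, x, y] w ∧
      ([x, y, x].map (letterElt hn ζ)).prod = ([y, x, y].map (letterElt hn ζ)).prod := by
  have h1 : y.lo hn = x.hi hn := by simp [Fin.ext_iff, hxy]
  have h2 : x.lo hn ≠ x.hi hn := lo_ne_hi hn x
  have h3 : y.hi hn ≠ x.hi hn := by simp [Fin.ext_iff, hxy]
  have h4 : y.hi hn ≠ x.lo hn := by simp [Fin.ext_iff, hxy]; omega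
  have hy1 : y.scalar ζ = 1 := scalar_eq_one ζ (by omega)
  -- The outer pair inherits the descent condition: the alternatives would either violate
  -- transitivity of the order or make the middle entry both equal to 1 and different from 1.
  have hac : (perm w (x.lo hn) < perm w (y.hi hn) ∧ coef w (y.hi hn) ≠ 1) ∨
      (perm w (y.hi hn) < perm w (x.lo hn) ∧ x.scalar ζ * coef w (x.lo hn) = 1) := by
    simp only [IsDescent, h1, hy1, one_mul] at hx hy
    rcases lt_or_gt_of_ne ((perm w).injective.ne h4) with h | h
    · right
      refine ⟨h, ?_⟩
      rcases hx with ⟨a, b⟩ | ⟨a, b⟩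
      · rcases hy with ⟨c, d⟩ | ⟨c, d⟩
        · exact absurd h (a.trans c).not_gt
        · exact absurd d b
      · exact b
    · left
      refine ⟨h, ?_⟩
      rcases hy with ⟨c, d⟩ | ⟨c, d⟩
      · exact d
      · rcases hx with ⟨a, b⟩ | ⟨a, b⟩
        · exact absurd d b
        · exact absurd h (c.trans a).not_gt
  refine ⟨?_, ?_, ?_⟩
  · refine isReducedPrefix_cons hn hζ hx (isReducedPrefix_cons hn hζ ?_
      ((isReducedPrefix_singleton hn hζ).2 ?_))
    · simpa only [IsDescent, perm_letter_mul', coef_letter_mul, h1, h2, h3, h4, h2.symm, h3.symm,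
        h4.symm, hy1, one_mul, if_true, if_false] using hac
    · simp only [IsDescent, h1, hy1, one_mul] at hy
      simpa only [IsDescent, perm_letter_mul', coef_letter_mul, h1, h2, h3, h4, h2.symm, h3.symm,
        h4.symm, hy1, one_mul, inv_one, if_true, if_false, mul_inv_cancel_left] using hy
  · refine isReducedPrefix_cons hn hζ hy (isReducedPrefix_cons hn hζ ?_
      ((isReducedPrefix_singleton hn hζ).2 ?_))
    · simpa only [IsDescent, perm_letter_mul', coef_letter_mul, h1, h2, h3, h4, h2.symm, h3.symm,
        h4.symm, hy1, one_mul, inv_one, if_true, if_false] using hac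
    · simpa only [IsDescent, perm_letter_mul', coef_letter_mul, h1, h2, h3, h4, h2.symm, h3.symm,
        h4.symm, hy1, one_mul, inv_one, if_true, if_false] using hx
  · simp only [List.map_cons, List.map_nil, List.prod_cons, List.prod_nil]
    apply Geen.ext_perm_coef <;> intro r
    · simp only [perm_letter_mul', h1, h2, h3, h4, h2.symm, h3.symm, h4.symm, if_true, if_false]
      split_ifs <;> simp_all
    · simp only [coef_letter_mul, h1, h2, h3, h4, h2.symm, h3.symm, h4.symm, hy1, one_mul,
        inv_one, if_true, if_false]
      split_ifs <;> simp_all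

lemma comm_isReducedPrefix [NeZero e] (hζ : IsPrimitiveRoot ζ e) {x y : Letter e n}
    (hxy : x.pos + 1 < y.pos) {w : Geen e n} (hx : IsDescent hn ζ x w)
    (hy : IsDescent hn ζ y w) :
    IsReducedPrefix (letterElt hn ζ) [x, y] w ∧ IsReducedPrefix (letterElt hn ζ) [y, x] w ∧
      ([x, y].map (letterElt hn ζ)).prod = ([y, x].map (letterElt hn ζ)).prod := by
  have h1 : y.lo hn ≠ x.lo hn := by simp [Fin.ext_iff]; omega
  have h2 : y.lo hn ≠ x.hi hn := by simp [Fin.ext_iff]; omega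
  have h3 : y.hi hn ≠ x.lo hn := by simp [Fin.ext_iff]; omega
  have h4 : y.hi hn ≠ x.hi hn := by simp [Fin.ext_iff]; omega
  refine ⟨?_, ?_, ?_⟩
  · refine isReducedPrefix_cons hn hζ hx ((isReducedPrefix_singleton hn hζ).2 ?_)
    simpa only [IsDescent, perm_letter_mul', coef_letter_mul, h1, h2, h3, h4, if_false] using hy
  · refine isReducedPrefix_cons hn hζ hy ((isReducedPrefix_singleton hn hζ).2 ?_)
    simpa only [IsDescent, perm_letter_mul', coef_letter_mul, h1.symm, h2.symm, h3.symm, h4.symm,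
      if_false] using hx
  · simp only [List.map_cons, List.map_nil, List.prod_cons, List.prod_nil]
    apply Geen.ext_perm_coef <;> intro r
    · simp only [perm_letter_mul', h1, h2, h3, h4, h1.symm, h2.symm, h3.symm, h4.symm, if_false]
      split_ifs <;> simp_all
    · simp only [coef_letter_mul, h1, h2, h3, h4, h1.symm, h2.symm, h3.symm, h4.symm, if_false]
      split_ifs <;> simp_all

lemma pow_val_sub_mul_pow [NeZero e] (hζ : IsPrimitiveRoot ζ e) (i : ZMod e) (k : ℕ) :
    ζ ^ (i - (k : ZMod e)).val * ζ ^ k = ζ ^ i.val := by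
  rw [← pow_add]
  have h : (i - (k : ZMod e)).val + k ≡ i.val [MOD e] := by
    rw [← ZMod.natCast_eq_natCast_iff]
    simp
  have hmod := pow_mod_orderOf ζ
  rw [← hζ.eq_orderOf] at hmod
  rw [← hmod, h, hmod]

/-- After t_i the first two rows are inverted and the first entry is ζ^(k-i), so the next t-letter
is a descent exactly when its scalar is ζ^(i-k). -/
lemma dual_isReducedPrefix [NeZero e] (hζ : IsPrimitiveRoot ζ e) {k : ℕ} {w : Geen e n}
    (hk : ζ ^ k ≠ 1) (h1 : perm w ⟨0, by omega⟩ < perm w ⟨1, hn⟩)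
    (h2 : coef w ⟨1, hn⟩ = ζ ^ k) (i : ZMod e) :
    IsReducedPrefix (letterElt hn ζ) [.t i, .t (i - (k : ZMod e))] w := by
  refine isReducedPrefix_cons hn hζ (Or.inl ⟨h1, ?_⟩) ((isReducedPrefix_singleton hn hζ).2
    (Or.inr ⟨?_, ?_⟩))
  · rw [← h2] at hk
    exact hk
  · simpa [perm_letter_mul', lo, Letter.hi, pos] using h1
  · have h3 : coef w ((Letter.t i : Letter e n).hi hn) = ζ ^ k := h2
    rw [show (Letter.t (i - (k : ZMod e)) : Letter e n).lo hn = (Letter.t i).lo hn from rfl,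
      coef_letter_mul, if_pos rfl, h3]
    simp only [scalar]
    rw [← pow_val_sub_mul_pow hζ i k]
    group

/-- Both products are the diagonal matrix diag(ζ^(-k), ζ^k, 1, …, 1). -/
lemma dual_prod_eq [NeZero e] (hζ : IsPrimitiveRoot ζ e) (k : ℕ) (i j : ZMod e) :
    (([.t i, .t (i - (k : ZMod e))] : List (Letter e n)).map (letterElt hn ζ)).prod
      = ([.t j, .t (j - (k : ZMod e))].map (letterElt hn ζ)).prod := by
  have hlo : ∀ m : ZMod e, (Letter.t m : Letter e n).lo hn = ⟨0, by omega⟩ := fun _ => rfl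
  have hhi : ∀ m : ZMod e, (Letter.t m : Letter e n).hi hn = ⟨1, hn⟩ := fun _ => rfl
  have h0 : (⟨1, hn⟩ : Fin n) ≠ ⟨0, by omega⟩ := by simp
  simp only [List.map_cons, List.map_nil, List.prod_cons, List.prod_nil]
  apply Geen.ext_perm_coef <;> intro r
  · simp only [perm_letter_mul', hlo, hhi]
  · simp only [coef_letter_mul, hlo, hhi, coef_one, scalar, h0, if_true, if_false]
    rw [← pow_val_sub_mul_pow hζ i k, ← pow_val_sub_mul_pow hζ j k]
    split_ifs
    · group
    · simp [mul_comm]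
    · rfl

/-! ## The relations of `B^{⊕k}(e,e,n)` -/

lemma BMonoid.braid (k : ℕ) {x y : Letter e n} (hxy : y.pos = x.pos + 1) :
    ([x, y, x].map (PresentedMonoid.of (BRel e n k))).prod
      = ([y, x, y].map (PresentedMonoid.of (BRel e n k))).prod := by
  simp only [List.map_cons, List.map_nil, List.prod_cons, List.prod_nil, mul_one, ← mul_assoc]
  cases y with
  | t i => simp [pos] at hxy
  | s j h3 hj =>
    cases x with
    | t i =>
      simp only [pos] at hxy
      obtain rfl : j = 3 := by omega
      exact (PresentedMonoid.mk_eq_mk_of_rel (BRel.braid_st hj i)).symm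
    | s i h3' hi =>
      simp only [pos] at hxy
      exact PresentedMonoid.mk_eq_mk_of_rel (BRel.braid_ss i j h3' hi h3 hj (by omega))

lemma BMonoid.comm (k : ℕ) {x y : Letter e n} (hxy : x.pos + 1 < y.pos) :
    ([x, y].map (PresentedMonoid.of (BRel e n k))).prod
      = ([y, x].map (PresentedMonoid.of (BRel e n k))).prod := by
  simp only [List.map_cons, List.map_nil, List.prod_cons, List.prod_nil, mul_one]
  cases y with
  | t i => simp [pos] at hxy
  | s j h3 hj =>
    cases x with
    | t i =>
      simp only [pos] at hxy
      exact (PresentedMonoid.mk_eq_mk_of_rel (BRel.comm_st j (by omega) hj i)).symm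
    | s i h3' hi =>
      simp only [pos] at hxy
      exact PresentedMonoid.mk_eq_mk_of_rel (BRel.comm_ss i j h3' hi h3 hj (by omega))

lemma exists_common_reducedPrefix [NeZero e] (hζ : IsPrimitiveRoot ζ e) {k : ℕ}
    (hk : ζ ^ k ≠ 1) {w : Geen e n}
    (hw : w ∈ interval (letterElt hn ζ) (lambdaElt hn ζ ^ k)) {x y : Letter e n}
    (hx : IsDescent hn ζ x w) (hy : IsDescent hn ζ y w) :
    ∃ u v, IsReducedPrefix (letterElt hn ζ) (x :: u) w ∧
      IsReducedPrefix (letterElt hn ζ) (y :: v) w ∧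
      ((x :: u).map (letterElt hn ζ)).prod = ((y :: v).map (letterElt hn ζ)).prod ∧
      ((x :: u).map (PresentedMonoid.of (BRel e n k))).prod
        = ((y :: v).map (PresentedMonoid.of (BRel e n k))).prod := by
  wlog hxy : x.pos ≤ y.pos generalizing x y
  · obtain ⟨u, v, h1, h2, h3, h4⟩ := this hy hx (by omega)
    exact ⟨v, u, h2, h1, h3.symm, h4.symm⟩
  by_cases hne : x = y
  · subst hne
    have := (isReducedPrefix_singleton hn hζ).2 hx
    exact ⟨[], [], this, this, rfl, rfl⟩
  rcases Nat.lt_or_ge (x.pos + 1) y.pos with h | h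
  · obtain ⟨h1, h2, h3⟩ := comm_isReducedPrefix hn hζ h hx hy
    exact ⟨[y], [x], h1, h2, h3, BMonoid.comm k h⟩
  rcases Nat.eq_or_lt_of_le hxy with h' | h'
  · cases x with
    | t i =>
      cases y with
      | t j =>
        -- On inverted rows a descent t_i has ζ^i inverse to the first entry, which fixes i; two
        -- different t-descents exclude this.
        have h1 : perm w ⟨0, by omega⟩ < perm w ⟨1, hn⟩ := by
          rcases hx with ⟨h, -⟩ | ⟨h, hi⟩
          · exact h
          · rcases hy with ⟨h', -⟩ | ⟨-, hj⟩
            · exact h'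
            · refine absurd ?_ hne
              have hij : ζ ^ i.val = ζ ^ j.val := mul_right_cancel (hi.trans hj.symm)
              rw [ZMod.val_injective e (hζ.pow_inj i.val_lt j.val_lt hij)]
        -- The only use of membership in the interval: the entry is 1 or ζ^k, and the descent
        -- excludes 1.
        have h2 : coef w ⟨1, hn⟩ = ζ ^ k := by
          refine ((mem_interval_lambdaElt_pow_iff hn hζ hk).1 hw _ _ (by simp) h1).resolve_left ?_
          rcases hx with ⟨-, h⟩ | ⟨h, -⟩
          · exact h
          · exact absurd h1 h.not_gt
        refine ⟨_, _, dual_isReducedPrefix hn hζ hk h1 h2 i, dual_isReducedPrefix hn hζ hk h1 h2 j,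
          dual_prod_eq hn hζ k i j, ?_⟩
        simp only [List.map_cons, List.map_nil, List.prod_cons, List.prod_nil, mul_one]
        exact PresentedMonoid.mk_eq_mk_of_rel (BRel.dual_tt i j)
      | s j h3 hj => simp only [pos] at h'; omega
    | s i h3 hi =>
      cases y with
      | t j => simp only [pos] at h'; omega
      | s j h3' hj =>
        simp only [pos] at h'
        obtain rfl : i = j := by omega
        exact absurd rfl hne
  · have h := Nat.le_antisymm h h'
    obtain ⟨h1, h2, h3⟩ := braid_isReducedPrefix hn hζ h hx hy
    exact ⟨[y, x], [x, y], h1, h2, h3, BMonoid.braid k h⟩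

/-- Every letter is a descent of λ^k, whose rows are in order and whose entries below the first are
ζ^k ≠ 1; the local lemmas therefore apply to λ^k itself. -/
lemma BRel.isReducedPrefix [NeZero e] (hζ : IsPrimitiveRoot ζ e) {k : ℕ} (hk : ζ ^ k ≠ 1)
    {a b : FreeMonoid (Letter e n)} (h : BRel e n k a b) :
    IsReducedPrefix (letterElt hn ζ) a.toList (lambdaElt hn ζ ^ k) ∧
      IsReducedPrefix (letterElt hn ζ) b.toList (lambdaElt hn ζ ^ k) ∧
      (a.toList.map (letterElt hn ζ)).prod = (b.toList.map (letterElt hn ζ)).prod := by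
  have hd := isDescent_lambdaElt_pow hn hk
  cases h with
  | braid_ss i j hi3 hin hj3 hjn hij =>
    rcases hij with h | h
    · exact braid_isReducedPrefix hn hζ (by simp only [pos]; omega) (hd _) (hd _)
    · obtain ⟨h1, h2, h3⟩ := braid_isReducedPrefix hn hζ (x := .s j hj3 hjn) (y := .s i hi3 hin)
        (by simp only [pos]; omega) (hd _) (hd _)
      exact ⟨h2, h1, h3.symm⟩
  | comm_ss i j hi3 hin hj3 hjn hij =>
    rcases hij with h | h
    · exact comm_isReducedPrefix hn hζ (by simp only [pos]; omega) (hd _) (hd _)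
    · obtain ⟨h1, h2, h3⟩ := comm_isReducedPrefix hn hζ (x := .s j hj3 hjn) (y := .s i hi3 hin)
        (by simp only [pos]; omega) (hd _) (hd _)
      exact ⟨h2, h1, h3.symm⟩
  | braid_st h3n i =>
    obtain ⟨h1, h2, h3⟩ := braid_isReducedPrefix hn hζ (x := .t i) (y := .s 3 le_rfl h3n)
      (by simp only [pos]) (hd _) (hd _)
    exact ⟨h2, h1, h3.symm⟩
  | comm_st j hj4 hjn i =>
    obtain ⟨h1, h2, h3⟩ := comm_isReducedPrefix hn hζ (x := .t i) (y := .s j (by omega) hjn)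
      (by simp only [pos]; omega) (hd _) (hd _)
    exact ⟨h2, h1, h3.symm⟩
  | dual_tt i j =>
    have h0 : (⟨0, by omega⟩ : Fin n) < ⟨1, hn⟩ := by simp
    have h1 : perm (lambdaElt hn ζ ^ k) ⟨0, by omega⟩ < perm (lambdaElt hn ζ ^ k) ⟨1, hn⟩ := by
      rwa [(perm_coef_lambdaElt_pow hn k).1, (perm_coef_lambdaElt_pow hn k).1]
    have h2 := coef_lambdaElt_pow_of_lt hn (ζ := ζ) k h0
    exact ⟨dual_isReducedPrefix hn hζ hk h1 h2 i, dual_isReducedPrefix hn hζ hk h1 h2 j,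
      dual_prod_eq hn hζ k i j⟩

end Interval

end IntervalStructure

/-! ### The presentation of the interval monoid -/

open IntervalStructure in
theorem mainTheorem3 (e n k : ℕ) (hn : 2 ≤ n) (hk : 1 ≤ k) (hke : k ≤ e - 1)
    (ζ : rootsOfUnity e ℂ) (hζ : IsPrimitiveRoot ζ e) :
    -- the map `F` on `[1, λ^k]` given by reduced expressions is well defined
    (∃! F : interval (letterElt hn ζ) (lambdaElt hn ζ ^ k) → BMonoid e n k,
      ∀ (w : interval (letterElt hn ζ) (lambdaElt hn ζ ^ k)) (l : List (Letter e n)),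
        IsReducedExpression (letterElt hn ζ) l (w : Geen e n) → F w = BMonoid.ofWord k l) ∧
    -- `B^{⊕k}(e,e,n)` is isomorphic to `M([1, λ^k])`, with generators matched in the obvious way
    (∃ φ : BMonoid e n k ≃* IntervalMonoid (letterElt hn ζ) (lambdaElt hn ζ ^ k),
      ∀ x : Letter e n,
        ∃ hx : letterElt hn ζ x ∈ interval (letterElt hn ζ) (lambdaElt hn ζ ^ k),
          φ (PresentedMonoid.of (BRel e n k) x) =
            PresentedMonoid.of (IntervalRel (letterElt hn ζ) (lambdaElt hn ζ ^ k))
              ⟨letterElt hn ζ x, hx⟩) := by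
  have : NeZero e := ⟨by omega⟩
  have hk1 : ζ ^ k ≠ 1 := hζ.pow_ne_one_of_pos_of_lt (by omega) (by omega)
  refine existsUnique_map_and_exists_mulEquiv_intervalMonoid (represents_and_len hn hζ).1
    (BRel e n k) (lambdaElt hn ζ ^ k) ?_ ?_ ?_ ?_
  · intro w hw x hx
    rw [letterElt_inv]
    exact letterElt_mul_mem_interval hn hζ hk1 hw ((isReducedPrefix_singleton hn hζ).1 hx)
  · exact fun x => (isReducedPrefix_singleton hn hζ).2 (isDescent_lambdaElt_pow hn hk1 x)
  · exact fun a b h => h.isReducedPrefix hn hζ hk1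
  · intro w hw x y hx hy
    exact exists_common_reducedPrefix hn hζ hk1 hw ((isReducedPrefix_singleton hn hζ).1 hx)
      ((isReducedPrefix_singleton hn hζ).1 hy)
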